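/- Let $m,p,q,r$ be integers with $m\neq 0$, and consider the Riccati equation $$z'=z^2+t^{-2}F(t),\qquad F(t)=\frac14\left[m^2(1-q^2)\left(\frac{t^m}{t^m-1}\right)^2-\bigl[r^2-p^2+m^2(1-q^2)\bigr]\frac{t^m}{t^m-1}+(1-p^2)\right],$$ in the complex variable $t$. Suppose that $m\nmid p$ and that, for some integer $j\in\{0,\ldots,q-1\}$ (in particular $q\geq 1$), either $p-r=(q-1-2j)m$ or $p+r=(q-1-2j)m$. Then all the solutions of the equation are meromorphic on $\mathbb{C}$ and, in fact, rational. That is, if $U\subset\{t\in\mathbb{C} : t\neq 0,\ t^m\neq 1\}$ is a nonempty connected open set and $z\colon U\to\mathbb{C}$ is a holomorphic solution of the equation, then there is a rational function $R\in\mathbb{C}(t)$, which is a meromorphic function on $\mathbb{C}$ without poles in $U$, such that $z=R$ on $U$ and such that $R$ satisfies the equation at every $t$ with $t\neq 0$ and $t^m\neq 1$ which is not a pole of $R$. -/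

import Mathlib

/-- The rational function
`F(t) = (1/4) [m²(1-q²) X² - (r² - p² + m²(1-q²)) X + (1 - p²)]` with `X = t^m / (t^m - 1)`. -/
noncomputable def riccatiF (m p q r : ℤ) (t : ℂ) : ℂ :=
  (1 / 4 : ℂ) *
    ((m : ℂ) ^ 2 * (1 - (q : ℂ) ^ 2) * (t ^ m / (t ^ m - 1)) ^ 2
      - ((r : ℂ) ^ 2 - (p : ℂ) ^ 2 + (m : ℂ) ^ 2 * (1 - (q : ℂ) ^ 2)) * (t ^ m / (t ^ m - 1))
      + (1 - (p : ℂ) ^ 2))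

/-- The complement in `ℂ` of the points where the right-hand side is given by a vanishing
denominator: the origin and the roots of `t^m = 1`. -/
def riccatiDomain (m : ℤ) : Set ℂ :=
  {t : ℂ | t ≠ 0 ∧ t ^ m ≠ 1}

/-- `z` is a (holomorphic) solution of `z' = z² + t⁻² F(t)` at every point of `U`. It is used for
open subsets `U` of `riccatiDomain m`. -/
def IsRiccatiSolutionOn (m p q r : ℤ) (z : ℂ → ℂ) (U : Set ℂ) : Prop :=
  ∀ t ∈ U, HasDerivAt z (z t ^ 2 + (t ^ 2)⁻¹ * riccatiF m p q r t) t

/-- The function on `ℂ` defined by a rational function; its value is meaningful at the points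
where the reduced denominator does not vanish. -/
noncomputable def ratFun (R : RatFunc ℂ) (t : ℂ) : ℂ :=
  R.eval (RingHom.id ℂ) t

/-- The complement in `ℂ` of the poles of a rational function. -/
def ratFunDomain (R : RatFunc ℂ) : Set ℂ :=
  {t : ℂ | R.denom.eval t ≠ 0}

/-! ### Terminating hypergeometric series -/

open Polynomial

/-! Writing `z = -y'/y` turns the equation into `y'' + t⁻² F y = 0`, and `y = t^((1-p)/2)
(1-t^m)^((1-q)/2) u` turns this into a hypergeometric equation for `u` in `s = t^m`. Its exponents
at `t = 0` are `p` and `0`; `m ∤ p` keeps the denominators of both recurrences nonzero, and the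
condition on `j` makes both series terminate, at the indices `j` and `q-1-j`. This gives solutions
`t^p P(t^m)` and `Q(t^m)` (`exists_hypergeometric_polynomial_int`).

No existence or uniqueness theory is needed to reach an arbitrary `z`. If `y'' + t⁻² F y = 0`, then
`W = z y + y'` satisfies `W' = z W`, the same equation for every `y` (`hasDerivAt_linForm`, up to
the gauge factor). The two forms `W` are therefore locally proportional, so some nontrivial
combination `u` has `W = 0`. As `u` does not vanish identically (`linear_relation_trivial`), `z =
-y'/y` is rational near a point, and the identity theorem does the rest. -/

/-- Coefficients of the hypergeometric-type polynomial: the solution with `c 0 = 1` of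
`4 m (i + 1) (m (i + 1) + a) c (i + 1) = ((2 m i + A)² - r²) c i`. -/
noncomputable def hypCoeff (m a A r : ℂ) : ℕ → ℂ
  | 0 => 1
  | i + 1 => ((2 * m * i + A) ^ 2 - r ^ 2) / (4 * m * (i + 1) * (m * (i + 1) + a)) *
      hypCoeff m a A r i

lemma hypCoeff_rec {m a A r : ℂ} (hm : m ≠ 0) (ha : ∀ i : ℕ, m * (i + 1) + a ≠ 0) (i : ℕ) :
    4 * m * (i + 1) * (m * (i + 1) + a) * hypCoeff m a A r (i + 1) =
      ((2 * m * i + A) ^ 2 - r ^ 2) * hypCoeff m a A r i := by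
  have h1 : (i + 1 : ℂ) ≠ 0 := by exact_mod_cast Nat.succ_ne_zero i
  have h2 := ha i
  rw [hypCoeff]
  field_simp

lemma hypCoeff_eq_zero {m a A r : ℂ} {n : ℕ} (hn : (2 * m * n + A) ^ 2 = r ^ 2) {i : ℕ}
    (hi : n < i) : hypCoeff m a A r i = 0 := by
  induction i, hi using Nat.le_induction with
  | base => rw [hypCoeff, hn]; simp
  | succ i _ ih => rw [hypCoeff, ih, mul_zero]

/-- The Euler operator `X d/dX` on polynomials. -/
noncomputable def eulerOp (P : ℂ[X]) : ℂ[X] := X * derivative P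

lemma coeff_eulerOp (P : ℂ[X]) (i : ℕ) : (eulerOp P).coeff i = i * P.coeff i := by
  cases i with
  | zero => simp [eulerOp]
  | succ i => simp [eulerOp, coeff_X_mul, coeff_derivative, mul_comm]

/-- A terminating hypergeometric series is a polynomial solution of its differential equation. -/
lemma exists_hypergeometric_polynomial {m a A r : ℂ} (hm : m ≠ 0)
    (ha : ∀ i : ℕ, m * (i + 1) + a ≠ 0) {n : ℕ} (hn : (2 * m * n + A) ^ 2 = r ^ 2) :
    ∃ P : ℂ[X], P ≠ 0 ∧
      X * (C (4 * m ^ 2) * eulerOp (eulerOp P) + C (4 * m * A) * eulerOp P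
          + C (A ^ 2 - r ^ 2) * P) =
        C (4 * m ^ 2) * eulerOp (eulerOp P) + C (4 * m * a) * eulerOp P := by
  set P : ℂ[X] := ∑ i ∈ Finset.range (n + 1), C (hypCoeff m a A r i) * X ^ i with hP
  have hc : ∀ i, P.coeff i = hypCoeff m a A r i := by
    intro i
    simp only [hP, finsetSum_coeff, coeff_C_mul, coeff_X_pow, mul_ite, mul_one, mul_zero,
      Finset.sum_ite_eq, Finset.mem_range]
    split_ifs with h
    · rfl
    · exact (hypCoeff_eq_zero hn (by lia)).symm
  refine ⟨P, fun h0 => ?_, ?_⟩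
  · have := hc 0
    rw [h0] at this
    simp [hypCoeff] at this
  · ext i
    cases i with
    | zero => simp only [mul_coeff_zero, coeff_X_zero, coeff_add, coeff_eulerOp]; simp
    | succ i =>
      simp only [coeff_X_mul, coeff_add, coeff_C_mul, coeff_eulerOp, hc]
      have := hypCoeff_rec (A := A) (r := r) hm ha i
      push_cast
      linear_combination -this

/-! ### Reduction to a first order linear equation -/

lemma hasDerivAt_zpow_mul_eval_zpow (m e : ℤ) (P : ℂ[X]) {t : ℂ} (ht : t ≠ 0) :
    HasDerivAt (fun t : ℂ => t ^ e * P.eval (t ^ m))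
      (t⁻¹ * (t ^ e * (C (e : ℂ) * P + C (m : ℂ) * eulerOp P).eval (t ^ m))) t := by
  have h1 := hasDerivAt_zpow e t (Or.inl ht)
  have h2 := hasDerivAt_zpow m t (Or.inl ht)
  have h3 := h1.mul ((P.hasDerivAt (t ^ m)).comp t h2)
  refine h3.congr_deriv ?_
  simp only [eulerOp, eval_add, eval_mul, eval_C, eval_X, zpow_sub_one₀ ht, Function.comp_apply]
  ring

/-- `t λ` where `λ` is the logarithmic derivative of `t^((1-p)/2) (1-t^m)^((1-q)/2)`. -/
noncomputable def riccatiGauge (m p q : ℤ) (t : ℂ) : ℂ :=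
  (1 - p) / 2 + (1 - q) / 2 * m * (t ^ m / (t ^ m - 1))

lemma hasDerivAt_riccatiGauge (m p q : ℤ) {t : ℂ} (ht : t ∈ riccatiDomain m) :
    HasDerivAt (riccatiGauge m p q)
      (t⁻¹ * (-((1 - q) / 2 * m ^ 2 * (t ^ m / (t ^ m - 1) ^ 2)))) t := by
  have h1 : t ^ m - 1 ≠ 0 := sub_ne_zero.2 ht.2
  have h2 := hasDerivAt_zpow m t (Or.inl ht.1)
  have h3 := ((h2.div (h2.sub_const 1) h1).const_mul ((1 - (q : ℂ)) / 2 * m)).const_add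
    ((1 - (p : ℂ)) / 2)
  refine h3.congr_deriv ?_
  rw [zpow_sub_one₀ ht.1]
  have := ht.1
  field_simp
  ring

/-- The combination of a solution `z` of the Riccati equation and `u = t^e P(t^m)` whose vanishing
expresses that `z` is minus the logarithmic derivative of the gauged `u`. -/
noncomputable def linForm (m p q e : ℤ) (P : ℂ[X]) (z : ℂ → ℂ) (t : ℂ) : ℂ :=
  (t * z t + riccatiGauge m p q t) * (t ^ e * P.eval (t ^ m)) +
    t ^ e * (C (e : ℂ) * P + C (m : ℂ) * eulerOp P).eval (t ^ m)

/-- For a polynomial solution of the hypergeometric equation, `linForm` satisfies a first order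
linear equation which does not depend on the polynomial. -/
lemma hasDerivAt_linForm {m p q r e a : ℤ} {P : ℂ[X]} (hea : 2 * e = p + a)
    (hpa : a ^ 2 = p ^ 2)
    (hP : X * (C (4 * (m : ℂ) ^ 2) * eulerOp (eulerOp P) +
          C (4 * (m : ℂ) * (a + (1 - q) * m)) * eulerOp P
          + C (((a : ℂ) + (1 - q) * m) ^ 2 - (r : ℂ) ^ 2) * P) =
        C (4 * (m : ℂ) ^ 2) * eulerOp (eulerOp P) + C (4 * (m : ℂ) * a) * eulerOp P)
    {z : ℂ → ℂ} {t : ℂ} (ht : t ∈ riccatiDomain m)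
    (hz : HasDerivAt z (z t ^ 2 + (t ^ 2)⁻¹ * riccatiF m p q r t) t) :
    HasDerivAt (linForm m p q e P z)
      (t⁻¹ * ((t * z t + 1 - riccatiGauge m p q t) * linForm m p q e P z t)) t := by
  have h1 : t ^ m - 1 ≠ 0 := sub_ne_zero.2 ht.2
  have h0 := ht.1
  have hd := ((((hasDerivAt_id t).mul hz).add (hasDerivAt_riccatiGauge m p q ht)).mul
    (hasDerivAt_zpow_mul_eval_zpow m e P h0)).add
    (hasDerivAt_zpow_mul_eval_zpow m e (C (e : ℂ) * P + C (m : ℂ) * eulerOp P) h0)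
  refine hd.congr_deriv ?_
  have hE : eulerOp (C (e : ℂ) * P + C (m : ℂ) * eulerOp P) =
      C (e : ℂ) * eulerOp P + C (m : ℂ) * eulerOp (eulerOp P) := by
    ext i; simp only [coeff_eulerOp, coeff_add, coeff_C_mul]; ring
  have hPs := congrArg (Polynomial.eval (t ^ m)) hP
  have hpa' : (a : ℂ) ^ 2 = p ^ 2 := by exact_mod_cast hpa
  -- With `a² = p²` this leaves `e = p` or `e = 0`, the two exponents, treated together.
  obtain rfl : a = 2 * e - p := by lia
  simp only [linForm, hE, eval_add, eval_mul, eval_C, eval_X, riccatiGauge, riccatiF, id,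
    Pi.mul_apply, Pi.add_apply] at hPs ⊢
  push_cast at hPs hpa' ⊢
  generalize eval (t ^ m) P = P0 at *
  generalize eval (t ^ m) (eulerOp P) = P1 at *
  generalize eval (t ^ m) (eulerOp (eulerOp P)) = P2 at *
  generalize t ^ m = s at *
  generalize t ^ e = w at *
  generalize z t = y at *
  -- The second order equation for the gauged `u`, multiplied by `4 t²` and with the factor `t^e`
  -- removed: `4 t² (u'' + 2 λ u' + (λ' + λ² + t⁻² F) u) = 0`.
  have key : 4 * (e * (e * P0 + m * P1) + m * (e * P1 + m * P2)) +
      4 * (2 * ((1 - p) / 2 + (1 - q) / 2 * m * (s / (s - 1))) - 1) * (e * P0 + m * P1) +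
      4 * (-((1 - q) / 2 * m ^ 2 * (s / (s - 1) ^ 2)) +
        ((1 - p) / 2 + (1 - q) / 2 * m * (s / (s - 1))) ^ 2 -
        ((1 - p) / 2 + (1 - q) / 2 * m * (s / (s - 1))) +
        1 / 4 * (m ^ 2 * (1 - q ^ 2) * (s / (s - 1)) ^ 2 -
          (r ^ 2 - p ^ 2 + m ^ 2 * (1 - q ^ 2)) * (s / (s - 1)) + (1 - p ^ 2))) * P0 = 0 := by
    field_simp
    linear_combination 4 * (s - 1) * hPs + 4 * (1 - s) * P0 * hpa'
  generalize s / (s - 1) ^ 2 = Y at *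
  generalize s / (s - 1) = X at *
  field_simp
  linear_combination 4 * w * key

/-! ### Linear relations and independence -/

open Filter Topology Set

/-- Two solutions of the same first order linear equation are locally proportional. -/
lemma exists_eventually_linear_relation {U : Set ℂ} (hUo : IsOpen U) (hU : U.Nonempty)
    {f g a : ℂ → ℂ} (hf : ∀ t ∈ U, HasDerivAt f (a t * f t) t)
    (hg : ∀ t ∈ U, HasDerivAt g (a t * g t) t) :
    ∃ t₀ ∈ U, ∃ α β : ℂ, (α ≠ 0 ∨ β ≠ 0) ∧ ∀ᶠ t in 𝓝 t₀, α * f t + β * g t = 0 := by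
  by_cases h : ∃ t₀ ∈ U, g t₀ ≠ 0
  · obtain ⟨t₀, ht₀, hne⟩ := h
    have hev : ∀ᶠ t in 𝓝 t₀, t ∈ U ∧ g t ≠ 0 :=
      (hUo.eventually_mem ht₀).and ((hg t₀ ht₀).continuousAt.eventually_ne hne)
    obtain ⟨ε, hε, hball⟩ := Metric.eventually_nhds_iff_ball.1 hev
    have hd : ∀ t ∈ Metric.ball t₀ ε, HasDerivAt (fun t => f t / g t) 0 t := by
      intro t ht
      refine ((hf t (hball t ht).1).div (hg t (hball t ht).1) (hball t ht).2).congr_deriv ?_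
      rw [div_eq_zero_iff]; left; ring
    obtain ⟨c, hc⟩ := Metric.isOpen_ball.exists_is_const_of_deriv_eq_zero
      (convex_ball t₀ ε).isPreconnected
      (fun t ht => (hd t ht).differentiableAt.differentiableWithinAt)
      (fun t ht => (hd t ht).deriv)
    refine ⟨t₀, ht₀, 1, -c, Or.inl one_ne_zero, ?_⟩
    filter_upwards [Metric.ball_mem_nhds t₀ hε] with t ht
    have := hc t ht
    rw [div_eq_iff (hball t ht).2] at this
    rw [this]; ring
  · push Not at h
    obtain ⟨t₀, ht₀⟩ := hU
    refine ⟨t₀, ht₀, 0, 1, Or.inr one_ne_zero, ?_⟩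
    filter_upwards [hUo.mem_nhds ht₀] with t ht
    simp [h t ht]

/-- `t ↦ t^m` maps `ℂ \ {0}` onto itself, so otherwise `P` would vanish off `0`; the factor `X` in
the proof takes care of `0`. -/
lemma exists_ne_zero_eval_zpow_ne_zero {m : ℤ} (hm : m ≠ 0) {P : ℂ[X]} (hP : P ≠ 0) :
    ∃ t : ℂ, t ≠ 0 ∧ P.eval (t ^ m) ≠ 0 := by
  by_contra! h
  have hXP : X * P = 0 := by
    refine Polynomial.funext fun s => ?_
    rcases eq_or_ne s 0 with rfl | hs
    · simp
    · have hm' : (m : ℂ) ≠ 0 := Int.cast_ne_zero.2 hm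
      have := h (Complex.exp (Complex.log s / m)) (Complex.exp_ne_zero _)
      rw [← Complex.exp_int_mul, mul_div_cancel₀ _ hm', Complex.exp_log hs] at this
      simp [this]
  exact hP ((mul_eq_zero.1 hXP).resolve_left X_ne_zero)

lemma isPreconnected_compl_of_finite {s : Set ℂ} (hs : s.Finite) : IsPreconnected sᶜ :=
  (hs.countable.isPathConnected_compl_of_one_lt_rank
    (by rw [Complex.rank_real_complex]; norm_num)).isConnected.isPreconnected

/-- If `m ∤ p`, functions `t^p P(t^m)` and `Q(t^m)` are linearly independent near any point. -/
lemma linear_relation_trivial {m p : ℤ} (hm : m ≠ 0) (hp : ¬ m ∣ p) {P Q : ℂ[X]} (hP : P ≠ 0)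
    (hQ : Q ≠ 0) {α β t₀ : ℂ} (ht₀ : t₀ ≠ 0)
    (h : ∀ᶠ t in 𝓝 t₀, α * (t ^ p * P.eval (t ^ m)) +
      β * (t ^ (0 : ℤ) * Q.eval (t ^ m)) = 0) :
    α = 0 ∧ β = 0 := by
  have hd : DifferentiableOn ℂ (fun t : ℂ => α * (t ^ p * P.eval (t ^ m)) +
      β * (t ^ (0 : ℤ) * Q.eval (t ^ m))) ({0}ᶜ : Set ℂ) := fun t ht =>
    (((hasDerivAt_zpow_mul_eval_zpow m p P ht).const_mul α).add
      ((hasDerivAt_zpow_mul_eval_zpow m 0 Q ht).const_mul β)).differentiableAt.differentiableWithinAt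
  have hall := (hd.analyticOnNhd
      isOpen_compl_singleton).eqOn_zero_of_preconnected_of_eventuallyEq_zero
      (isPreconnected_compl_of_finite (finite_singleton 0)) (z₀ := t₀) ht₀ h
  have hm' : (m : ℂ) ≠ 0 := Int.cast_ne_zero.2 hm
  -- Monodromy: `t ↦ ω t` fixes `t^m` but multiplies `t^p` by `ω^p ≠ 1`, so comparing the relation
  -- at `t` and `ω t` separates its two terms.
  set ω : ℂ := Complex.exp (2 * Real.pi * Complex.I / m) with hω
  have hωm : ω ^ m = 1 := by
    rw [hω, ← Complex.exp_int_mul, mul_div_cancel₀ _ hm', Complex.exp_two_pi_mul_I]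
  have hωp : ω ^ p ≠ 1 := by
    rw [hω, ← Complex.exp_int_mul, Ne, Complex.exp_eq_one_iff]
    rintro ⟨n, hn⟩
    refine hp ⟨n, ?_⟩
    have h2 := Complex.two_pi_I_ne_zero
    have : (p : ℂ) = m * n := by
      rw [mul_div_assoc', div_eq_iff hm'] at hn
      exact mul_right_cancel₀ h2 (by linear_combination hn)
    exact_mod_cast this
  have hrel : ∀ t : ℂ, t ≠ 0 → α * (t ^ p * P.eval (t ^ m)) = 0 ∧ β * Q.eval (t ^ m) = 0 := by
    intro t ht
    have h1 := hall (show t ∈ ({0}ᶜ : Set ℂ) from ht)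
    have h2 := hall (show ω * t ∈ ({0}ᶜ : Set ℂ) from mul_ne_zero (Complex.exp_ne_zero _) ht)
    simp only [mul_zpow, hωm, one_mul, zpow_zero, Pi.zero_apply] at h1 h2
    have h3 : α * (t ^ p * P.eval (t ^ m)) = 0 :=
      (mul_eq_zero.1 (show (ω ^ p - 1) * (α * (t ^ p * P.eval (t ^ m))) = 0 by
        linear_combination h2 - h1)).resolve_left (sub_ne_zero.2 hωp)
    exact ⟨h3, by linear_combination h1 - h3⟩
  constructor
  · obtain ⟨t, ht, hne⟩ := exists_ne_zero_eval_zpow_ne_zero hm hP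
    exact (mul_eq_zero.1 (hrel t ht).1).resolve_right (mul_ne_zero (zpow_ne_zero _ ht) hne)
  · obtain ⟨t, ht, hne⟩ := exists_ne_zero_eval_zpow_ne_zero hm hQ
    exact (mul_eq_zero.1 (hrel t ht).2).resolve_right hne

/-! ### Quotients of polynomials -/

/-- `f` is on `S` a quotient of polynomials whose denominator has no zeros in `S`. -/
def IsPolyQuotientOn (S : Set ℂ) (f : ℂ → ℂ) : Prop :=
  ∃ A B : ℂ[X], ∀ t ∈ S, B.eval t ≠ 0 ∧ f t * B.eval t = A.eval t

namespace IsPolyQuotientOn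

variable {S : Set ℂ} {f g : ℂ → ℂ}

lemma const (c : ℂ) : IsPolyQuotientOn S fun _ => c := ⟨C c, 1, fun t _ => by simp⟩

lemma id : IsPolyQuotientOn S fun t => t := ⟨X, 1, fun t _ => by simp⟩

lemma add (hf : IsPolyQuotientOn S f) (hg : IsPolyQuotientOn S g) :
    IsPolyQuotientOn S fun t => f t + g t := by
  obtain ⟨A, B, h⟩ := hf
  obtain ⟨A', B', h'⟩ := hg
  refine ⟨A * B' + A' * B, B * B', fun t ht => ⟨?_, ?_⟩⟩
  · rw [eval_mul]; exact mul_ne_zero (h t ht).1 (h' t ht).1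
  · simp only [eval_add, eval_mul]
    linear_combination B'.eval t * (h t ht).2 + B.eval t * (h' t ht).2

lemma mul (hf : IsPolyQuotientOn S f) (hg : IsPolyQuotientOn S g) :
    IsPolyQuotientOn S fun t => f t * g t := by
  obtain ⟨A, B, h⟩ := hf
  obtain ⟨A', B', h'⟩ := hg
  refine ⟨A * A', B * B', fun t ht => ⟨?_, ?_⟩⟩
  · rw [eval_mul]; exact mul_ne_zero (h t ht).1 (h' t ht).1
  · simp only [eval_mul, ← (h t ht).2, ← (h' t ht).2]; ring

lemma inv (hf : IsPolyQuotientOn S f) (hne : ∀ t ∈ S, f t ≠ 0) :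
    IsPolyQuotientOn S fun t => (f t)⁻¹ := by
  obtain ⟨A, B, h⟩ := hf
  refine ⟨B, A, fun t ht => ?_⟩
  rw [← (h t ht).2]
  exact ⟨mul_ne_zero (hne t ht) (h t ht).1, inv_mul_cancel_left₀ (hne t ht) _⟩

lemma pow (hf : IsPolyQuotientOn S f) (n : ℕ) : IsPolyQuotientOn S fun t => f t ^ n := by
  induction n with
  | zero => simpa using const 1
  | succ n ih => simpa only [pow_succ] using ih.mul hf

lemma zpow (hS : ∀ t ∈ S, t ≠ 0) (n : ℤ) : IsPolyQuotientOn S fun t => t ^ n := by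
  cases n with
  | ofNat n => simpa using id.pow n
  | negSucc n =>
    simpa only [zpow_negSucc] using (id.pow (n + 1)).inv fun t ht => pow_ne_zero _ (hS t ht)

lemma eval (hf : IsPolyQuotientOn S f) (P : ℂ[X]) : IsPolyQuotientOn S fun t => P.eval (f t) := by
  induction P using Polynomial.induction_on' with
  | add P Q hP hQ => simpa only [eval_add] using hP.add hQ
  | monomial n a => simpa only [eval_monomial] using (const a).mul (hf.pow n)

/-- A function determined near a point by a linear equation with rational coefficients
is rational there. -/
lemma exists_eventually_mul_eq (hf : IsPolyQuotientOn S f) (hg : IsPolyQuotientOn S g)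
    {t₀ : ℂ} (hS : S ∈ 𝓝 t₀) {z : ℂ → ℂ} (hz : ∀ᶠ t in 𝓝 t₀, z t * f t = g t)
    (hne : ¬ ∀ᶠ t in 𝓝 t₀, f t = 0) :
    ∃ A B : ℂ[X], B ≠ 0 ∧ ∀ᶠ t in 𝓝 t₀, z t * B.eval t = A.eval t := by
  obtain ⟨A, B, h⟩ := hf
  obtain ⟨A', B', h'⟩ := hg
  refine ⟨A' * B, A * B', ?_, ?_⟩
  · refine mul_ne_zero ?_ ?_
    · rintro rfl
      refine hne ?_
      filter_upwards [hS] with t ht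
      have := (h t ht).2
      rw [eval_zero] at this
      exact (mul_eq_zero.1 this).resolve_right (h t ht).1
    · rintro rfl
      exact (h' t₀ (mem_of_mem_nhds hS)).1 eval_zero
  · filter_upwards [hS, hz] with t ht hzt
    simp only [eval_mul, ← (h t ht).2, ← (h' t ht).2, ← hzt]
    ring

end IsPolyQuotientOn

/-! ### From local to global rationality -/

lemma finite_compl_riccatiDomain {m : ℤ} (hm : m ≠ 0) : (riccatiDomain m)ᶜ.Finite := by
  have hX : (X ^ m.natAbs - 1 : ℂ[X]) ≠ 0 :=
    X_pow_sub_C_ne_zero (Nat.pos_of_ne_zero (Int.natAbs_ne_zero.2 hm)) 1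
  refine ((finite_singleton (0 : ℂ)).union (finite_setOfPred_isRoot hX)).subset ?_
  intro t ht
  by_cases h0 : t = 0
  · exact Or.inl h0
  · refine Or.inr ?_
    have h1 : t ^ m = 1 := by
      by_contra h
      exact ht ⟨h0, h⟩
    have h2 : t ^ m.natAbs = 1 := by
      rcases Int.natAbs_eq m with h | h
      · rwa [h, zpow_natCast] at h1
      · rwa [h, zpow_neg, zpow_natCast, inv_eq_one] at h1
    simp [IsRoot, h2]

lemma isOpen_riccatiDomain {m : ℤ} (hm : m ≠ 0) : IsOpen (riccatiDomain m) :=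
  compl_compl (riccatiDomain m) ▸ (finite_compl_riccatiDomain hm).isClosed.isOpen_compl

lemma differentiableAt_riccatiF (m p q r : ℤ) {t : ℂ} (ht : t ∈ riccatiDomain m) :
    DifferentiableAt ℂ (riccatiF m p q r) t := by
  have h1 : t ^ m - 1 ≠ 0 := sub_ne_zero.2 ht.2
  have h2 : DifferentiableAt ℂ (fun t : ℂ => t ^ m) t := differentiableAt_zpow.2 (Or.inl ht.1)
  have h3 : DifferentiableAt ℂ (fun t : ℂ => t ^ m / (t ^ m - 1)) t :=
    h2.div (h2.sub_const 1) h1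
  exact ((((h3.pow 2).const_mul _).sub (h3.const_mul _)).add_const _).const_mul _

lemma ratFun_eq_div (R : RatFunc ℂ) (t : ℂ) : ratFun R t = R.num.eval t / R.denom.eval t := by
  simp [ratFun, RatFunc.eval, eval₂_id]

lemma differentiableAt_ratFun {R : RatFunc ℂ} {t : ℂ} (ht : t ∈ ratFunDomain R) :
    DifferentiableAt ℂ (ratFun R) t := by
  rw [show ratFun R = fun t => R.num.eval t / R.denom.eval t from funext (ratFun_eq_div R)]
  exact R.num.differentiable.differentiableAt.div R.denom.differentiable.differentiableAt ht

lemma meromorphicOn_ratFun (R : RatFunc ℂ) (S : Set ℂ) : MeromorphicOn (ratFun R) S := by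
  rw [show ratFun R = (fun t => R.num.eval t) / fun t => R.denom.eval t from
    funext (ratFun_eq_div R)]
  intro t _
  exact (R.num.differentiable.analyticAt t).meromorphicAt.div
    (R.denom.differentiable.analyticAt t).meromorphicAt

lemma finite_compl_ratFunDomain (R : RatFunc ℂ) : (ratFunDomain R)ᶜ.Finite :=
  (finite_setOfPred_isRoot R.denom_ne_zero).subset fun _ ht => not_not.1 ht

/-- A holomorphic function which is a quotient of polynomials near one point is the restriction of a rational
function without poles on its domain. -/
lemma exists_ratFunc_eqOn {U : Set ℂ} (hUo : IsOpen U) (hUc : IsPreconnected U) {z : ℂ → ℂ}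
    (hz : DifferentiableOn ℂ z U) {t₀ : ℂ} (ht₀ : t₀ ∈ U) {A B : ℂ[X]} (hB : B ≠ 0)
    (h : ∀ᶠ t in 𝓝 t₀, z t * B.eval t = A.eval t) :
    ∃ R : RatFunc ℂ, U ⊆ ratFunDomain R ∧ EqOn z (ratFun R) U := by
  set R : RatFunc ℂ := algebraMap ℂ[X] (RatFunc ℂ) A / algebraMap ℂ[X] (RatFunc ℂ) B with hR
  have hcross : R.num * B = A * R.denom :=
    (RatFunc.num_mul_eq_mul_denom_iff hB).2 hR
  have hprod : EqOn (fun t => B.eval t * (z t * R.denom.eval t - R.num.eval t)) 0 U := by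
    refine AnalyticOnNhd.eqOn_zero_of_preconnected_of_eventuallyEq_zero (𝕜 := ℂ)
      (DifferentiableOn.analyticOnNhd ?_ hUo) hUc ht₀ ?_
    · exact B.differentiable.differentiableOn.mul
        ((hz.mul R.denom.differentiable.differentiableOn).sub
          R.num.differentiable.differentiableOn)
    · filter_upwards [h] with t ht
      have := congrArg (Polynomial.eval t) hcross
      simp only [eval_mul] at this
      simp only [Pi.zero_apply]
      linear_combination R.denom.eval t * ht - this
  -- The factor `B` cancels off its finitely many roots, and at the roots by continuity.
  have hzR : ∀ t ∈ U, z t * R.denom.eval t = R.num.eval t := by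
    intro t ht
    have hc : ContinuousAt (fun t => z t * R.denom.eval t - R.num.eval t) t :=
      ((hz.differentiableAt (hUo.mem_nhds ht)).continuousAt.mul
        R.denom.continuous.continuousAt).sub R.num.continuous.continuousAt
    have hev : ∀ᶠ s in 𝓝[≠] t, z s * R.denom.eval s - R.num.eval s = 0 := by
      have hfin : ({s | IsRoot B s} \ {t})ᶜ ∈ 𝓝[≠] t :=
        mem_nhdsWithin_of_mem_nhds
          (((finite_setOfPred_isRoot hB).subset sdiff_subset).isClosed.isOpen_compl.mem_nhds
            (by simp))
      filter_upwards [hfin, self_mem_nhdsWithin,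
        mem_nhdsWithin_of_mem_nhds (hUo.mem_nhds ht)] with s hs hne hsU
      refine (mul_eq_zero.1 (hprod hsU)).resolve_left fun hb => hs ⟨hb, hne⟩
    have hlim := hc.tendsto.mono_left (nhdsWithin_le_nhds (s := {t}ᶜ))
    exact sub_eq_zero.1 (tendsto_nhds_unique hlim (tendsto_const_nhds.congr' (hev.mono
      fun s hs => hs.symm)))
  -- As `z` is finite on `U`, a zero of the denominator there would also be a zero of the numerator,
  -- against coprimality.
  have hden : U ⊆ ratFunDomain R := by
    intro t ht h0
    have h1 := hzR t ht
    rw [h0, mul_zero] at h1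
    obtain ⟨a, b, hab⟩ := R.isCoprime_num_denom
    have := congrArg (Polynomial.eval t) hab
    simp [h0, ← h1] at this
  refine ⟨R, hden, fun t ht => ?_⟩
  rw [ratFun_eq_div, eq_div_iff (hden ht)]
  exact hzR t ht

/-- A rational function which solves the Riccati equation on a nonempty open set solves it
everywhere. -/
lemma isRiccatiSolutionOn_ratFun {m p q r : ℤ} (hm : m ≠ 0) {U : Set ℂ} (hUo : IsOpen U)
    (hUne : U.Nonempty) (hU : U ⊆ riccatiDomain m) {R : RatFunc ℂ} (hUR : U ⊆ ratFunDomain R)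
    (hR : IsRiccatiSolutionOn m p q r (ratFun R) U) :
    IsRiccatiSolutionOn m p q r (ratFun R) (riccatiDomain m ∩ ratFunDomain R) := by
  obtain ⟨t₀, ht₀⟩ := hUne
  set V := riccatiDomain m ∩ ratFunDomain R
  have hfin : Vᶜ.Finite := by
    rw [compl_inter]
    exact (finite_compl_riccatiDomain hm).union (finite_compl_ratFunDomain R)
  have hVo : IsOpen V := compl_compl V ▸ hfin.isClosed.isOpen_compl
  have hVc : IsPreconnected V := compl_compl V ▸ isPreconnected_compl_of_finite hfin
  have hRd : DifferentiableOn ℂ (ratFun R) V := fun t ht =>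
    (differentiableAt_ratFun ht.2).differentiableWithinAt
  have hrhs : DifferentiableOn ℂ
      (fun t => ratFun R t ^ 2 + (t ^ 2)⁻¹ * riccatiF m p q r t) V := fun t ht =>
    (((differentiableAt_ratFun ht.2).pow 2).add
      (((differentiableAt_id.pow 2).inv (pow_ne_zero 2 ht.1.1)).mul
        (differentiableAt_riccatiF m p q r ht.1))).differentiableWithinAt
  -- `V` has finite complement, hence is connected, and the identity theorem applies to both sides
  -- of the equation.
  have heq := (hRd.analyticOnNhd hVo).deriv.eqOn_of_preconnected_of_eventuallyEq
    (hrhs.analyticOnNhd hVo) hVc (show t₀ ∈ V from ⟨hU ht₀, hUR ht₀⟩)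
    (by filter_upwards [hUo.mem_nhds ht₀] with t ht using (hR t ht).deriv)
  intro t ht
  exact (differentiableAt_ratFun ht.2).hasDerivAt.congr_deriv (heq ht)

/-! ### Conclusion -/

/-- The polynomial factor of a solution of the linear equation associated with the Riccati
equation. -/
lemma exists_hypergeometric_polynomial_int {m a q r : ℤ} (hm : m ≠ 0) (ha : ¬ m ∣ a) {j : ℤ}
    (hj : 0 ≤ j) (h : a - r = (q - 1 - 2 * j) * m ∨ a + r = (q - 1 - 2 * j) * m) :
    ∃ P : ℂ[X], P ≠ 0 ∧
      X * (C (4 * (m : ℂ) ^ 2) * eulerOp (eulerOp P) +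
          C (4 * (m : ℂ) * (a + (1 - q) * m)) * eulerOp P
          + C (((a : ℂ) + (1 - q) * m) ^ 2 - (r : ℂ) ^ 2) * P) =
        C (4 * (m : ℂ) ^ 2) * eulerOp (eulerOp P) + C (4 * (m : ℂ) * a) * eulerOp P := by
  lift j to ℕ using hj
  refine exists_hypergeometric_polynomial (n := j) (Int.cast_ne_zero.2 hm) (fun i h0 => ha ?_) ?_
  · refine ⟨-(i + 1), ?_⟩
    have : m * (i + 1) + a = 0 := by exact_mod_cast h0
    linear_combination this
  · have : (2 * m * j + (a + (1 - q) * m)) ^ 2 = r ^ 2 := by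
      rcases h with h | h
      · rw [show 2 * m * j + (a + (1 - q) * m) = r by linear_combination h]
      · rw [show 2 * m * j + (a + (1 - q) * m) = -r by linear_combination h, neg_sq]
    exact_mod_cast this

lemma isPolyQuotientOn_zpow_mul_eval (m e : ℤ) (P : ℂ[X]) :
    IsPolyQuotientOn (riccatiDomain m) fun t => t ^ e * P.eval (t ^ m) :=
  (IsPolyQuotientOn.zpow (fun _ ht => ht.1) e).mul
    ((IsPolyQuotientOn.zpow (fun _ ht => ht.1) m).eval P)

lemma isPolyQuotientOn_riccatiGauge (m p q : ℤ) :
    IsPolyQuotientOn (riccatiDomain m) (riccatiGauge m p q) := by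
  have h1 : IsPolyQuotientOn (riccatiDomain m) fun t => t ^ m := .zpow (fun _ ht => ht.1) m
  have h2 := (h1.add (.const (-1))).inv fun t ht => by
    rw [← sub_eq_add_neg]; exact sub_ne_zero.2 ht.2
  have h3 := (IsPolyQuotientOn.const ((1 - (p : ℂ)) / 2)).add
    ((IsPolyQuotientOn.const ((1 - (q : ℂ)) / 2 * m)).mul (h1.mul h2))
  simp only [← sub_eq_add_neg, ← div_eq_mul_inv] at h3
  exact h3

theorem mainTheorem4 (m p q r : ℤ) (hm : m ≠ 0) (hp : ¬ m ∣ p)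
    (hj : ∃ j : ℤ, 0 ≤ j ∧ j ≤ q - 1 ∧
      (p - r = (q - 1 - 2 * j) * m ∨ p + r = (q - 1 - 2 * j) * m))
    (U : Set ℂ) (hUo : IsOpen U) (hUc : IsConnected U) (hU : U ⊆ riccatiDomain m)
    (z : ℂ → ℂ) (hz : IsRiccatiSolutionOn m p q r z U) :
    ∃ R : RatFunc ℂ,
      MeromorphicOn (ratFun R) Set.univ ∧
      IsRiccatiSolutionOn m p q r (ratFun R) (riccatiDomain m ∩ ratFunDomain R) ∧
      U ⊆ ratFunDomain R ∧
      Set.EqOn z (ratFun R) U := by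
  obtain ⟨j, hj0, hjq, hj⟩ := hj
  obtain ⟨P, hP0, hP⟩ := exists_hypergeometric_polynomial_int hm hp hj0 hj
  -- Under `p ↦ -p`, `j ↦ q-1-j` the two alternatives in `hj` change places; `j ≤ q-1` makes the new
  -- index nonnegative.
  obtain ⟨Q, hQ0, hQ⟩ := exists_hypergeometric_polynomial_int (a := -p) (q := q) (r := r)
    (j := q - 1 - j) hm (by rwa [dvd_neg]) (by lia)
    (hj.symm.imp (fun h => by linear_combination -h) (fun h => by linear_combination -h))
  obtain ⟨t₀, ht₀, α, β, hαβ, hrel⟩ := exists_eventually_linear_relation hUo hUc.nonempty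
    (f := linForm m p q p P z) (g := linForm m p q 0 Q z)
    (a := fun t => t⁻¹ * (t * z t + 1 - riccatiGauge m p q t))
    (fun t ht => (hasDerivAt_linForm (two_mul p) rfl hP (hU ht) (hz t ht)).congr_deriv
      (mul_assoc _ _ _).symm)
    (fun t ht => (hasDerivAt_linForm (by ring) (neg_sq p) hQ (hU ht) (hz t ht)).congr_deriv
      (mul_assoc _ _ _).symm)
  have hu := ((IsPolyQuotientOn.const α).mul (isPolyQuotientOn_zpow_mul_eval m p P)).add
    ((IsPolyQuotientOn.const β).mul (isPolyQuotientOn_zpow_mul_eval m 0 Q))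
  have hDu := ((IsPolyQuotientOn.const α).mul (isPolyQuotientOn_zpow_mul_eval m p
      (C (p : ℂ) * P + C (m : ℂ) * eulerOp P))).add
    ((IsPolyQuotientOn.const β).mul (isPolyQuotientOn_zpow_mul_eval m 0
      (C ((0 : ℤ) : ℂ) * Q + C (m : ℂ) * eulerOp Q)))
  have hzd : DifferentiableOn ℂ z U := fun t ht =>
    (hz t ht).differentiableAt.differentiableWithinAt
  -- The relation reads `z · (t u) = -(t λ u + t u')` for `u = α t^p P(t^m) + β Q(t^m)`, with `u`
  -- not locally zero.
  obtain ⟨A, B, hB, hAB⟩ := (IsPolyQuotientOn.id.mul hu).exists_eventually_mul_eq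
    ((IsPolyQuotientOn.const (-1)).mul (((isPolyQuotientOn_riccatiGauge m p q).mul hu).add hDu))
    ((isOpen_riccatiDomain hm).mem_nhds (hU ht₀)) (z := z)
    (by
      filter_upwards [hrel] with t ht
      simp only [linForm] at ht
      linear_combination ht)
    (by
      intro hzero
      have h0 := linear_relation_trivial hm hp hP0 hQ0 (hU ht₀).1 (α := α) (β := β) (by
        filter_upwards [hzero, hUo.mem_nhds ht₀] with t ht htU
        exact (mul_eq_zero.1 ht).resolve_left (hU htU).1)
      exact hαβ.elim (fun h => h h0.1) (fun h => h h0.2))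
  obtain ⟨R, hUR, hzR⟩ := exists_ratFunc_eqOn hUo hUc.isPreconnected hzd ht₀ hB hAB
  refine ⟨R, meromorphicOn_ratFun R _, isRiccatiSolutionOn_ratFun hm hUo hUc.nonempty hU hUR ?_,
    hUR, hzR⟩
  intro t ht
  rw [← hzR ht]
  exact (hz t ht).congr_of_eventuallyEq
    (by filter_upwards [hUo.mem_nhds ht] with s hs using (hzR hs).symm)
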